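/- For $\vec c\in\mathbb R^3$ let $\rho_{\vec c}=\frac14\big(\mathbb I\otimes\mathbb I+\sum_{i=1}^3 c_i\,\sigma_i\otimes\sigma_i\big)$, where $\sigma_1,\sigma_2,\sigma_3$ are the Pauli matrices. This is a two-qubit state (with maximally mixed marginals) when it is positive semidefinite, which is the case exactly when $\vec c$ lies in the solid tetrahedron $\mathcal T$ with vertices $(-1,-1,-1),(-1,1,1),(1,-1,1),(1,1,-1)$. For unit vectors $\hat n,\hat m\in S^2$ let $\mathcal I(\hat n,\hat m)$ be the classical mutual information (base-2 logarithms) $$\mathcal I(\hat n,\hat m)=-\sum_{i}p_i\log_2p_i-\sum_jp_j\log_2p_j+\sum_{i,j}p_{ij}\log_2p_{ij},\qquad i,j=\pm,$$ of the outcomes of the local observables $\hat n\cdot\vec\sigma$ and $\hat m\cdot\vec\sigma$, where $p_{ij}=\mathrm{Tr}[\rho_{\vec c}\,\Pi_i(\hat n)\otimes\Pi_j(\hat m)]$, $\Pi_\pm(\hat n)=(\mathbb I\pm\hat n\cdot\vec\sigma)/2$, and $p_i,p_j$ are the marginal probabilities. Let $\langle\mathcal I\rangle_\Omega(\vec c)$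 be the average of $\mathcal I(\hat n,\hat m)$ over $(\hat n,\hat m)\in\Omega=S^2\times S^2$ with respect to the uniform measure. Fix $\kappa\ge 0$ and let $\mathcal D_\kappa=\{\vec c:|\vec c|=\kappa,\ \rho_{\vec c}\ge0\}$. 1. Let $\kappa\le1$. Isotropic states $\vec c=\kappa(\pm1,\pm1,\pm1)/\sqrt3$ exist in $\mathcal D_\kappa$, and the points of $\mathcal D_\kappa$ at which $\langle\mathcal I\rangle_\Omega$ attains its minimum over $\mathcal D_\kappa$ are exactly the isotropic ones. The points at which it attains its maximum over $\mathcal D_\kappa$ are exactly the "classical" ones, $\vec c\in\{\pm\kappa\hat x,\pm\kappa\hat y,\pm\kappa\hat z\}$, all of which lie in $\mathcal D_\kappa$. The same holds over the whole sphere $|\vec c|=\kappa$ (where all $p_{ij}$ are still nonnegative): the minimizers are exactly the points $\kappa(\pm1,\pm1,\pm1)/\sqrt3$ and the maximizers exactly the points $\pm\kappa\hat x,\pm\kappa\hat y,\pm\kappa\hat z$. 2. Let $1\le\kappa\le\sqrt3$. Isotropic states exist in $\mathcal D_\kappa$, and they are exactly the points of $\mathcal D_\kappa$ at which $\langle\mathcal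 I\rangle_\Omega$ attains its minimum over $\mathcal D_\kappa$. The maximum over $\mathcal D_\kappa$ is attained, and every maximizer (indeed every local maximizer of $\langle\mathcal I\rangle_\Omega$ on $\mathcal D_\kappa$) lies on the intersection of the sphere of radius $\kappa$ with the boundary of the tetrahedron $\mathcal T$. -/

import Mathlib

open MeasureTheory
open scoped Kronecker ComplexOrder

noncomputable section

namespace TwoQubit

/-- Euclidean three-space, where Bloch vectors and correlation vectors live. -/
abbrev E3 : Type := EuclideanSpace ℝ (Fin 3)

/-- The Bloch sphere `S²`. -/
abbrev S2 : Type := Metric.sphere (0 : E3) 1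

/-- Operators on one qubit. -/
abbrev Op1 : Type := Matrix (Fin 2) (Fin 2) ℂ

/-- Operators on two qubits. -/
abbrev Op2 : Type := Matrix (Fin 2 × Fin 2) (Fin 2 × Fin 2) ℂ

/-- The Pauli matrices `σ_x, σ_y, σ_z`. -/
def pauli : Fin 3 → Op1 :=
  ![!![0, 1; 1, 0], !![0, -Complex.I; Complex.I, 0], !![1, 0; 0, -1]]

/-- The matrix `(1/4) (𝟙 ⊗ 𝟙 + ∑ i, c i • σ_i ⊗ σ_i)` with correlation vector `c`. -/
def mmms (c : E3) : Op2 :=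
  (1 / 4 : ℂ) • ((1 : Op1) ⊗ₖ (1 : Op1) + ∑ i, (c i : ℂ) • (pauli i ⊗ₖ pauli i))

/-- Density matrices: positive semidefinite of trace one. -/
def IsDensityMatrix (ρ : Op2) : Prop := ρ.PosSemidef ∧ ρ.trace = 1

/-- The reduced matrix of the first qubit. -/
def reducedA (ρ : Op2) : Op1 := Matrix.of fun i j => ∑ k, ρ (i, k) (j, k)

/-- The reduced matrix of the second qubit. -/
def reducedB (ρ : Op2) : Op1 := Matrix.of fun i j => ∑ k, ρ (k, i) (k, j)

/-- The projector `Π_s(n) = (𝟙 + s n·σ) / 2` of the observable `n·σ`, for the outcome `s = ±1`. -/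
def proj (s : ℤˣ) (n : E3) : Op1 :=
  (1 / 2 : ℂ) • ((1 : Op1) + ((s : ℤ) : ℂ) • ∑ i, (n i : ℂ) • pauli i)

/-- Joint outcome probabilities `p_{st} = Tr[ρ Π_s(n) ⊗ Π_t(m)]`. -/
def jointProb (ρ : Op2) (n m : E3) (s t : ℤˣ) : ℝ :=
  (ρ * (proj s n ⊗ₖ proj t m)).trace.re

/-- Outcome probabilities of the first qubit, `Tr[ρ_A Π_s(n)]`. -/
def probA (ρ : Op2) (n : E3) (s : ℤˣ) : ℝ := (reducedA ρ * proj s n).trace.re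

/-- Outcome probabilities of the second qubit, `Tr[ρ_B Π_t(m)]`. -/
def probB (ρ : Op2) (m : E3) (t : ℤˣ) : ℝ := (reducedB ρ * proj t m).trace.re

/-- The classical mutual information (in bits) of the outcomes of `n·σ` on the first and `m·σ` on
the second qubit. -/
def mutualInfo (ρ : Op2) (n m : E3) : ℝ :=
  -(∑ s, probA ρ n s * Real.logb 2 (probA ρ n s))
    - (∑ t, probB ρ m t * Real.logb 2 (probB ρ m t))
    + ∑ s, ∑ t, jointProb ρ n m s t * Real.logb 2 (jointProb ρ n m s t)

/-- The surface measure of the unit sphere of Euclidean three-space. -/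
def surface : Measure S2 := (volume : Measure E3).toSphere

/-- The mutual information averaged over all pairs `(n, m)` in `Ω = S² × S²`. -/
def avgMutualInfo (ρ : Op2) : ℝ :=
  ⨍ p : S2 × S2, mutualInfo ρ p.1 p.2 ∂(surface.prod surface)

/-- `⟨I⟩_Ω` as a function of the correlation vector. -/
def avgInfo (c : E3) : ℝ := avgMutualInfo (mmms c)

/-- The directions `(s₁ c_{σ(1)}, s₂ c_{σ(2)}, s₃ c_{σ(3)})` equivalent to `c`, where the `s_i` are
signs and `σ` is a permutation. -/
def luClass (c : E3) : Set E3 :=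
  {d | ∃ (s : Fin 3 → ℤˣ) (σ : Equiv.Perm (Fin 3)), ∀ i, d i = ((s i : ℤ) : ℝ) * c (σ i)}

/-- The directions `(±1, ±1, ±1)/√3` of the isotropic states. -/
def isotropicDirs : Set E3 := luClass !₂[1 / √3, 1 / √3, 1 / √3]

/-- The directions `±e_i` of the classical states. -/
def classicalDirs : Set E3 := luClass !₂[0, 0, 1]

/-- The vectors `κ ĉ` with direction `ĉ` in the set `D`. -/
def scaled (κ : ℝ) (D : Set E3) : Set E3 := {c | ∃ d ∈ D, c = κ • d}

/-- The correlation vectors of length `κ` of (positive) states with maximally mixed marginals. -/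
def stateVectors (κ : ℝ) : Set E3 := {c | ‖c‖ = κ ∧ IsDensityMatrix (mmms c)}

/-- The tetrahedron `𝒯` (as a solid body). -/
def tetrahedron : Set E3 :=
  convexHull ℝ {!₂[-1, -1, -1], !₂[-1, 1, 1], !₂[1, -1, 1], !₂[1, 1, -1]}

/-- The points of `D` at which `⟨I⟩_Ω` attains its minimum over `D`. -/
def minimizers (D : Set E3) : Set E3 := {c | c ∈ D ∧ IsMinOn avgInfo D c}

/-- The points of `D` at which `⟨I⟩_Ω` attains its maximum over `D`. -/
def maximizers (D : Set E3) : Set E3 := {c | c ∈ D ∧ IsMaxOn avgInfo D c}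

end TwoQubit

end

open TwoQubit

/-!
The marginals of `mmms c` are maximally mixed, so the mutual information of the outcomes along `n`
and `m` is a function `corrInfo` of the single correlation `∑ i, c i * n i * m i`. As a function
of the square of the correlation it is strictly convex on `[0, 1]` (`strictConvexOn_sqCorrInfo`):
its derivative at `t` is a positive multiple of `artanh √t / √t`, a power series in `t` with
positive coefficients.

For fixed `m` the correlation is `⟪v, n⟫` with `v i = c i * m i`. Since the surface measure is
rotation invariant, the average over `n` does not change when `v` is replaced by `‖v‖ e₀`, and then
the square of the correlation is `n 0 ^ 2 * ∑ i, c i ^ 2 * m i ^ 2`, which is linear in the squares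
`a i = c i ^ 2`. Hence `avgInfo c = avgSq a` (`avgInfo_eq_avgSq`), where `avgSq` is symmetric in the
coordinates (`avgSq_comp_perm`) and strictly convex on the unit cube (`strictConvexOn_avgSq`).
On the sphere of radius `κ` the point `a` runs over the simplex `∑ i, a i = κ ^ 2`. This gives
everything:

* the centre of the simplex, the isotropic case, is the strict minimum (`avgSq_const_lt`);
* if the whole simplex lies in the cube, its vertices, the classical case, are the strict maxima
  (`avgSq_lt_single`);
* a point `c` of the interior of the tetrahedron with `1 ≤ ‖c‖` has two nonzero coordinates, so `a`
  is the midpoint of a segment in the simplex which comes from states, and `c` is no local maximum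
  (`mem_frontier_of_isLocalMaxOn`).

The eigenvalues of `mmms c`, on the Bell basis, are the barycentric coordinates of `c` in the
tetrahedron, which identifies states with points of the tetrahedron (`mem_stateVectors_iff`).
-/

namespace TwoQubit

/-! ### The mutual information as a function of one correlation -/

/-- The mutual information, in bits, of two unbiased signs with correlation `x`. Only
`|x| ≤ 1` is meaningful, but the formula is continuous and even on all of `ℝ`. -/
noncomputable def corrInfo (x : ℝ) : ℝ :=
  ((1 + x) * Real.logb 2 (1 + x) + (1 - x) * Real.logb 2 (1 - x)) / 2

/-- The mutual information of two unbiased signs as a function of the square of their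
correlation. -/
noncomputable def sqCorrInfo (t : ℝ) : ℝ := corrInfo √t

theorem corrInfo_neg (x : ℝ) : corrInfo (-x) = corrInfo x := by
  simp only [corrInfo, sub_neg_eq_add, ← sub_eq_add_neg]
  ring

theorem corrInfo_eq_sqCorrInfo (x : ℝ) : corrInfo x = sqCorrInfo (x ^ 2) := by
  rw [sqCorrInfo, Real.sqrt_sq_eq_abs]
  rcases abs_choice x with h | h <;> rw [h]
  rw [corrInfo_neg]

theorem corrInfo_eq_log (x : ℝ) :
    corrInfo x = ((1 + x) * Real.log (1 + x) + (1 - x) * Real.log (1 - x)) / (2 * Real.log 2) := by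
  have : Real.log 2 ≠ 0 := (Real.log_pos one_lt_two).ne'
  simp only [corrInfo, Real.logb]
  field_simp

theorem continuous_corrInfo : Continuous corrInfo := by
  have h : corrInfo = fun x => ((1 + x) * Real.log (1 + x) + (1 - x) * Real.log (1 - x)) /
      (2 * Real.log 2) := funext corrInfo_eq_log
  rw [h]
  exact ((Real.continuous_mul_log.comp (continuous_const.add continuous_id)).add
    (Real.continuous_mul_log.comp (continuous_const.sub continuous_id))).div_const _

theorem continuous_sqCorrInfo : Continuous sqCorrInfo :=
  continuous_corrInfo.comp Real.continuous_sqrt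

theorem hasDerivAt_sqCorrInfo {t : ℝ} (h0 : 0 < t) (h1 : t < 1) :
    HasDerivAt sqCorrInfo
      ((Real.log (1 + √t) - Real.log (1 - √t)) / (2 * Real.log 2) * (1 / (2 * √t))) t := by
  have hs0 : 0 < √t := Real.sqrt_pos.2 h0
  have hs1 : √t < 1 := by rw [Real.sqrt_lt' one_pos]; simpa using h1
  have hc : HasDerivAt corrInfo
      ((Real.log (1 + √t) - Real.log (1 - √t)) / (2 * Real.log 2)) √t := by
    have hfun : corrInfo = fun x => ((1 + x) * Real.log (1 + x) + (1 - x) * Real.log (1 - x)) /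
      (2 * Real.log 2) := funext corrInfo_eq_log
    rw [hfun]
    have hp := (Real.hasDerivAt_mul_log (x := 1 + √t) (by linarith)).comp √t
      ((hasDerivAt_id √t).const_add 1)
    have hm := (Real.hasDerivAt_mul_log (x := 1 - √t) (by linarith)).comp √t
      ((hasDerivAt_id √t).const_sub 1)
    refine ((hp.add hm).div_const (2 * Real.log 2)).congr_deriv ?_
    ring
  exact hc.comp t (Real.hasDerivAt_sqrt h0.ne')

/-- The derivative is `artanh √t / √t` up to a positive factor; it increases because all
coefficients of its power series in `t` are positive. -/
theorem hasSum_deriv_sqCorrInfo {t : ℝ} (h0 : 0 < t) (h1 : t < 1) :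
    HasSum (fun k : ℕ => t ^ k / (2 * Real.log 2 * (2 * k + 1))) (deriv sqCorrInfo t) := by
  have hs0 : 0 < √t := Real.sqrt_pos.2 h0
  have hs1 : |√t| < 1 := by
    rw [abs_of_pos hs0, Real.sqrt_lt' one_pos]; simpa using h1
  have hl : 0 < Real.log 2 := Real.log_pos one_lt_two
  rw [(hasDerivAt_sqCorrInfo h0 h1).deriv]
  have := (Real.hasSum_log_sub_log_of_abs_lt_one hs1).mul_right
    (1 / (2 * Real.log 2) * (1 / (2 * √t)))
  convert! this using 1
  · funext k
    have : √t ^ (2 * k + 1) = t ^ k * √t := by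
      rw [pow_succ, pow_mul, Real.sq_sqrt h0.le]
    rw [this]
    have : (2 * (k : ℝ) + 1) ≠ 0 := by positivity
    field_simp
  · ring

theorem strictConvexOn_sqCorrInfo : StrictConvexOn ℝ (Set.Icc 0 1) sqCorrInfo := by
  refine StrictMonoOn.strictConvexOn_of_deriv (convex_Icc 0 1)
    continuous_sqCorrInfo.continuousOn ?_
  rw [interior_Icc]
  intro x hx y hy hxy
  have hl : 0 < Real.log 2 := Real.log_pos one_lt_two
  refine hasSum_lt (i := 1) (fun k => ?_) ?_ (hasSum_deriv_sqCorrInfo hx.1 hx.2)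
    (hasSum_deriv_sqCorrInfo hy.1 hy.2)
  · exact div_le_div_of_nonneg_right (pow_le_pow_left₀ hx.1.le hxy.le k) (by positivity)
  · exact div_lt_div_of_pos_right (by simpa using hxy) (by positivity)

/-! ### Outcome probabilities and positivity of the two-qubit matrices -/

theorem probA_mmms (c n : E3) (s : ℤˣ) : probA (mmms c) n s = 1 / 2 := by
  rcases Int.units_eq_one_or s with rfl | rfl <;>
  · simp [probA, reducedA, mmms, proj, pauli, Matrix.trace, Matrix.mul_apply, Fin.sum_univ_succ,
      Matrix.one_apply]
    try ring

theorem probB_mmms (c n : E3) (s : ℤˣ) : probB (mmms c) n s = 1 / 2 := by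
  rcases Int.units_eq_one_or s with rfl | rfl <;>
  · simp [probB, reducedB, mmms, proj, pauli, Matrix.trace, Matrix.mul_apply, Fin.sum_univ_succ,
      Matrix.one_apply]
    try ring

theorem jointProb_mmms (c n m : E3) (s t : ℤˣ) :
    jointProb (mmms c) n m s t =
      (1 + ((s : ℤ) : ℝ) * ((t : ℤ) : ℝ) * ∑ i, c i * n i * m i) / 4 := by
  rcases Int.units_eq_one_or s with rfl | rfl <;> rcases Int.units_eq_one_or t with rfl | rfl <;>
  · simp [jointProb, mmms, proj, pauli, Matrix.trace, Matrix.mul_apply, Fin.sum_univ_succ,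
      Matrix.one_apply, Fintype.sum_prod_type]
    ring

theorem sum_intUnits {M : Type*} [AddCommMonoid M] (f : ℤˣ → M) : ∑ s, f s = f 1 + f (-1) := by
  rw [show (Finset.univ : Finset ℤˣ) = {1, -1} from rfl, Finset.sum_pair (by decide)]

theorem mutualInfo_mmms (c n m : E3) :
    mutualInfo (mmms c) n m = corrInfo (∑ i, c i * n i * m i) := by
  -- This holds for `y = 0` as well, because of the factor in front of the logarithm.
  have key : ∀ y : ℝ, y / 4 * Real.logb 2 (y / 4) = (y * Real.logb 2 y - 2 * y) / 4 := by
    intro y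
    rcases eq_or_ne y 0 with rfl | hy
    · simp
    · rw [Real.logb_div hy (by norm_num), show (4 : ℝ) = 2 ^ (2 : ℝ) by norm_num,
        Real.logb_rpow (by norm_num) (by norm_num)]
      ring
  have half : Real.logb 2 (1 / 2) = -1 := by
    rw [one_div, Real.logb_inv, Real.logb_self_eq_one (by norm_num)]
  simp only [mutualInfo, probA_mmms, probB_mmms, jointProb_mmms, sum_intUnits, key, half, corrInfo]
  push_cast
  simp only [one_mul, mul_one, neg_mul, mul_neg, neg_neg, ← sub_eq_add_neg]
  ring

/-- The four vectors of the Bell basis, up to a factor `√2`: for `k = 0` the singlet, and for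
`k = 1, 2, 3` the triplets. -/
def bell : Fin 4 → Fin 2 × Fin 2 → ℂ :=
  ![fun p => !![0, 1; -1, 0] p.1 p.2, fun p => !![1, 0; 0, -1] p.1 p.2,
    fun p => !![1, 0; 0, 1] p.1 p.2, fun p => !![0, 1; 1, 0] p.1 p.2]

/-- The eigenvalues of `mmms c` on the Bell basis. -/
noncomputable def bellWeight (c : E3) : Fin 4 → ℝ :=
  ![(1 - c 0 - c 1 - c 2) / 4, (1 - c 0 + c 1 + c 2) / 4,
    (1 + c 0 - c 1 + c 2) / 4, (1 + c 0 + c 1 - c 2) / 4]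

theorem mmms_eq_sum_bell (c : E3) :
    mmms c = ∑ k, (bellWeight c k / 2) • Matrix.vecMulVec (bell k) (star (bell k)) := by
  ext ⟨i, j⟩ ⟨k, l⟩
  fin_cases i <;> fin_cases j <;> fin_cases k <;> fin_cases l <;>
  · simp [mmms, pauli, bell, bellWeight, Fin.sum_univ_succ, Matrix.vecMulVec_apply]
    try ring

theorem star_bell_dotProduct_mmms (c : E3) (k : Fin 4) :
    star (bell k) ⬝ᵥ (mmms c).mulVec (bell k) = ((2 * bellWeight c k : ℝ) : ℂ) := by
  fin_cases k <;>
  · simp [mmms, pauli, bell, bellWeight, Fin.sum_univ_succ, Matrix.mulVec, dotProduct,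
      Matrix.one_apply, Fintype.sum_prod_type]
    ring

theorem trace_mmms (c : E3) : (mmms c).trace = 1 := by
  simp [mmms, pauli, Matrix.trace, Fin.sum_univ_succ, Fintype.sum_prod_type]
  ring

theorem isDensityMatrix_mmms_iff (c : E3) :
    IsDensityMatrix (mmms c) ↔ ∀ k, 0 ≤ bellWeight c k := by
  constructor
  · rintro ⟨h, -⟩ k
    have := h.dotProduct_mulVec_nonneg (bell k)
    rw [star_bell_dotProduct_mmms, Complex.zero_le_real] at this
    linarith
  · intro h
    refine ⟨?_, trace_mmms c⟩
    rw [mmms_eq_sum_bell]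
    refine Matrix.posSemidef_sum _ fun k _ => ?_
    exact (Matrix.posSemidef_vecMulVec_self_star _).smul (div_nonneg (h k) zero_le_two)

/-- The eigenvalues of `mmms c` are the barycentric coordinates of `c` in the tetrahedron. -/
theorem mem_tetrahedron_iff (c : E3) : c ∈ tetrahedron ↔ ∀ k, 0 ≤ bellWeight c k := by
  constructor
  · intro h
    have hconv : Convex ℝ {c : E3 | ∀ k, 0 ≤ bellWeight c k} := by
      intro x hx y hy a b ha hb hab k
      have hk : bellWeight (a • x + b • y) k = a * bellWeight x k + b * bellWeight y k := by
        obtain rfl : b = 1 - a := by linarith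
        fin_cases k <;>
        · simp [bellWeight]
          ring
      rw [hk]
      exact add_nonneg (mul_nonneg ha (hx k)) (mul_nonneg hb (hy k))
    refine convexHull_min ?_ hconv h
    rintro x (rfl | rfl | rfl | rfl) k <;> fin_cases k <;>
    simp [bellWeight] <;> norm_num
  · intro h
    have hc : c = ∑ k, bellWeight c k • (![!₂[-1, -1, -1], !₂[-1, 1, 1], !₂[1, -1, 1],
        !₂[1, 1, -1]] : Fin 4 → E3) k := by
      ext i
      fin_cases i <;>
      · simp [bellWeight, Fin.sum_univ_succ]
        ring
    rw [hc]
    refine (convex_convexHull ℝ _).sum_mem (fun k _ => h k) ?_ fun k _ => subset_convexHull ℝ _ ?_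
    · simp [bellWeight, Fin.sum_univ_succ]
      ring
    · fin_cases k <;> simp

theorem mem_stateVectors_iff {κ : ℝ} {c : E3} :
    c ∈ stateVectors κ ↔ ‖c‖ = κ ∧ c ∈ tetrahedron := by
  rw [stateVectors, Set.mem_ofPred_eq, isDensityMatrix_mmms_iff, mem_tetrahedron_iff]

theorem isClosed_tetrahedron : IsClosed tetrahedron := by
  have h : tetrahedron = ⋂ k, {c : E3 | 0 ≤ bellWeight c k} := by
    ext c
    simp [mem_tetrahedron_iff]
  rw [h]
  refine isClosed_iInter fun k => isClosed_le continuous_const ?_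
  fin_cases k <;>
  · simp only [bellWeight]
    dsimp
    fun_prop

theorem sq_le_one_of_mem_tetrahedron {c : E3} (hc : c ∈ tetrahedron) (i : Fin 3) :
    c i ^ 2 ≤ 1 := by
  rw [mem_tetrahedron_iff, Fin.forall_fin_succ, Fin.forall_fin_succ, Fin.forall_fin_succ,
    Fin.forall_fin_one] at hc
  simp only [bellWeight] at hc
  obtain ⟨h0, h1, h2, h3⟩ := hc
  dsimp at h0 h1 h2 h3
  rw [sq_le_one_iff_abs_le_one, abs_le]
  fin_cases i <;> constructor <;> dsimp <;> linarith

/-! ### Averages over pairs of directions -/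

/-- The action of a linear isometry on the Bloch sphere. -/
noncomputable def sphereIsometry (e : E3 ≃ₗᵢ[ℝ] E3) : S2 ≃ₜ S2 :=
  e.toHomeomorph.subtype fun x => by simp

theorem coe_sphereIsometry (e : E3 ≃ₗᵢ[ℝ] E3) (x : S2) : (sphereIsometry e x : E3) = e x := rfl

instance : IsFiniteMeasure surface :=
  inferInstanceAs (IsFiniteMeasure (volume : Measure E3).toSphere)

instance : surface.IsOpenPosMeasure :=
  inferInstanceAs (volume : Measure E3).toSphere.IsOpenPosMeasure

open scoped Pointwise in
theorem measurePreserving_sphereIsometry (e : E3 ≃ₗᵢ[ℝ] E3) :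
    MeasurePreserving (sphereIsometry e) surface surface := by
  refine ⟨(sphereIsometry e).continuous.measurable, ?_⟩
  ext s hs
  rw [Measure.map_apply (sphereIsometry e).continuous.measurable hs, surface,
    Measure.toSphere_apply' _ hs,
    Measure.toSphere_apply' _ ((sphereIsometry e).continuous.measurable hs)]
  have hset : Set.Ioo (0 : ℝ) 1 • ((↑) '' (sphereIsometry e ⁻¹' s) : Set E3) =
      e ⁻¹' (Set.Ioo (0 : ℝ) 1 • ((↑) '' s : Set E3)) := by
    ext x
    simp only [Set.mem_smul, Set.mem_image, Set.mem_preimage]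
    constructor
    · rintro ⟨r, hr, _, ⟨y, hy, rfl⟩, rfl⟩
      exact ⟨r, hr, _, ⟨_, hy, rfl⟩, by rw [map_smul, coe_sphereIsometry]⟩
    · rintro ⟨r, hr, _, ⟨y, hy, rfl⟩, hx⟩
      refine ⟨r, hr, _, ⟨(sphereIsometry e).symm y, by simpa using hy, rfl⟩, ?_⟩
      apply e.injective
      rw [map_smul, ← coe_sphereIsometry, Homeomorph.apply_symm_apply, hx]
  rw [hset, e.measurePreserving.measure_preimage_emb e.toHomeomorph.measurableEmbedding]

theorem integral_sphereIsometry (e : E3 ≃ₗᵢ[ℝ] E3) (f : S2 → ℝ) :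
    ∫ x, f (sphereIsometry e x) ∂surface = ∫ x, f x ∂surface :=
  (measurePreserving_sphereIsometry e).integral_comp (sphereIsometry e).measurableEmbedding f

/-- By rotation invariance, the average of a function of `⟪v, n⟫` over the sphere depends on
`‖v‖` only. -/
theorem integral_inner_eq (f : ℝ → ℝ) (v w : E3) (h : ‖v‖ = ‖w‖) :
    ∫ n : S2, f (inner ℝ v n) ∂surface = ∫ n : S2, f (inner ℝ w n) ∂surface := by
  rw [← integral_sphereIsometry (Submodule.reflection (ℝ ∙ (v - w))ᗮ)
    (fun n : S2 => f (inner ℝ w n))]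
  congr 1
  funext n
  have hvw := LinearIsometryEquiv.inner_map_map (Submodule.reflection (ℝ ∙ (v - w))ᗮ) v (n : E3)
  rw [Submodule.reflection_sub h] at hvw
  rw [coe_sphereIsometry, hvw]

/-- The averaged mutual information as a function of the squares `a i = c i ^ 2`, after the
average over `n` has been rotated into the direction of the first axis. -/
noncomputable def avgSq (a : Fin 3 → ℝ) : ℝ :=
  ⨍ p : S2 × S2, sqCorrInfo ((p.1 : E3) 0 ^ 2 * ∑ i, a i * (p.2 : E3) i ^ 2)
    ∂(surface.prod surface)

theorem integrable_of_continuous_sphere {f : S2 × S2 → ℝ} (hf : Continuous f) :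
    Integrable f (surface.prod surface) :=
  hf.integrable_of_hasCompactSupport (HasCompactSupport.of_compactSpace f)

theorem continuous_avgSq_integrand :
    Continuous fun q : (Fin 3 → ℝ) × (S2 × S2) =>
      sqCorrInfo ((q.2.1 : E3) 0 ^ 2 * ∑ i, q.1 i * (q.2.2 : E3) i ^ 2) :=
  continuous_sqCorrInfo.comp (by fun_prop)

theorem integrable_avgSq_integrand (a : Fin 3 → ℝ) :
    Integrable (fun p : S2 × S2 =>
      sqCorrInfo ((p.1 : E3) 0 ^ 2 * ∑ i, a i * (p.2 : E3) i ^ 2)) (surface.prod surface) :=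
  integrable_of_continuous_sphere
    (continuous_avgSq_integrand.comp (Continuous.prodMk_right a))

theorem continuous_avgSq : Continuous avgSq := by
  have := continuous_parametric_integral_of_continuous (μ := surface.prod surface)
    (f := fun (a : Fin 3 → ℝ) (p : S2 × S2) =>
      sqCorrInfo ((p.1 : E3) 0 ^ 2 * ∑ i, a i * (p.2 : E3) i ^ 2))
    continuous_avgSq_integrand (s := Set.univ) isCompact_univ
  rw [Measure.restrict_univ] at this
  change Continuous fun a => avgSq a
  simp only [avgSq, average_eq]
  exact continuous_const.mul this

theorem avgInfo_eq_avgSq (c : E3) : avgInfo c = avgSq fun i => c i ^ 2 := by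
  simp only [avgInfo, avgMutualInfo, avgSq, average_eq, mutualInfo_mmms]
  congr 1
  have hcont : Continuous fun p : S2 × S2 => corrInfo (∑ i, c i * (p.1 : E3) i * (p.2 : E3) i) :=
    continuous_corrInfo.comp (by fun_prop)
  rw [integral_prod_symm _ (integrable_of_continuous_sphere hcont),
    integral_prod_symm _ (integrable_avgSq_integrand _)]
  congr 1
  funext m
  set v : E3 := WithLp.toLp 2 fun i => c i * (m : E3) i with hv
  have hnorm : ‖v‖ = ‖EuclideanSpace.single (0 : Fin 3) ‖v‖‖ := by simp
  convert integral_inner_eq corrInfo v (EuclideanSpace.single 0 ‖v‖) hnorm using 2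
  · funext n
    congr 1
    simp only [PiLp.inner_apply, hv, RCLike.inner_apply, conj_trivial]
    exact Finset.sum_congr rfl fun i _ => by ring
  · funext n
    rw [corrInfo_eq_sqCorrInfo, EuclideanSpace.inner_single_left, mul_pow]
    simp only [conj_trivial, EuclideanSpace.norm_sq_eq, hv, Real.norm_eq_abs, sq_abs, mul_pow]
    rw [mul_comm]

theorem continuous_avgInfo : Continuous avgInfo := by
  rw [show avgInfo = fun c => avgSq fun i => c i ^ 2 from funext avgInfo_eq_avgSq]
  exact continuous_avgSq.comp (by fun_prop)

theorem avgSq_comp_perm (a : Fin 3 → ℝ) (σ : Equiv.Perm (Fin 3)) :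
    avgSq (fun i => a (σ i)) = avgSq a := by
  simp only [avgSq, average_eq]
  congr 1
  rw [integral_prod _ (integrable_avgSq_integrand _),
    integral_prod _ (integrable_avgSq_integrand _)]
  congr 1
  funext n
  rw [← integral_sphereIsometry (LinearIsometryEquiv.piLpCongrLeft 2 ℝ ℝ σ.symm)]
  congr 1
  funext m
  congr 2
  rw [← Equiv.sum_comp σ (fun j => a j * (m : E3) j ^ 2)]
  simp [coe_sphereIsometry, LinearIsometryEquiv.piLpCongrLeft_apply]

theorem sum_sq_sphere (m : S2) : ∑ i, (m : E3) i ^ 2 = 1 := by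
  have h := EuclideanSpace.norm_sq_eq (m : E3)
  rw [norm_eq_of_mem_sphere] at h
  simpa using h.symm

theorem mem_Icc_of_cube {a : Fin 3 → ℝ} (ha : a ∈ Set.Icc 0 1) (n m : S2) :
    (n : E3) 0 ^ 2 * ∑ i, a i * (m : E3) i ^ 2 ∈ Set.Icc (0 : ℝ) 1 := by
  have h0 : 0 ≤ ∑ i, a i * (m : E3) i ^ 2 :=
    Finset.sum_nonneg fun i _ => mul_nonneg (ha.1 i) (sq_nonneg _)
  have h1 : ∑ i, a i * (m : E3) i ^ 2 ≤ 1 := by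
    exact (Finset.sum_le_sum fun i _ => mul_le_of_le_one_left (sq_nonneg _) (ha.2 i)).trans_eq
      (sum_sq_sphere m)
  have h2 : (n : E3) 0 ^ 2 ≤ 1 := by
    exact (Finset.single_le_sum (f := fun i => (n : E3) i ^ 2) (fun i _ => sq_nonneg _)
      (Finset.mem_univ 0)).trans_eq (sum_sq_sphere n)
  exact ⟨mul_nonneg (sq_nonneg _) h0, mul_le_one₀ h2 h0 h1⟩

/-- The integrand is convex in `a`; strictness comes from the directions `n = e₀` and `m = e_i`,
where `i` is a coordinate in which the two points differ, by continuity of the integrand. -/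
theorem strictConvexOn_avgSq : StrictConvexOn ℝ (Set.Icc 0 1) avgSq := by
  refine ⟨convex_Icc 0 1, fun x hx y hy hxy a b ha hb hab => ?_⟩
  let F : (Fin 3 → ℝ) → S2 × S2 → ℝ := fun a p =>
    sqCorrInfo ((p.1 : E3) 0 ^ 2 * ∑ i, a i * (p.2 : E3) i ^ 2)
  have hFi : ∀ a, Integrable (F a) (surface.prod surface) := integrable_avgSq_integrand
  have hFc : ∀ a, Continuous (F a) := fun a =>
    continuous_avgSq_integrand.comp (Continuous.prodMk_right a)
  have harg : ∀ p : S2 × S2, (p.1 : E3) 0 ^ 2 * ∑ i, (a • x + b • y) i * (p.2 : E3) i ^ 2 =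
      a • ((p.1 : E3) 0 ^ 2 * ∑ i, x i * (p.2 : E3) i ^ 2) +
      b • ((p.1 : E3) 0 ^ 2 * ∑ i, y i * (p.2 : E3) i ^ 2) := by
    intro p
    simp only [Fin.sum_univ_three, Pi.add_apply, Pi.smul_apply, smul_eq_mul]
    ring
  obtain ⟨i, hi⟩ := Function.ne_iff.1 hxy
  let u : Fin 3 → S2 := fun j => ⟨EuclideanSpace.single j 1, by simp⟩
  have hpos : 0 < ∫ p, (a * F x p + b * F y p - F (a • x + b • y) p) ∂(surface.prod surface) := by
    refine integral_pos_of_integrable_nonneg_nonzero (x := (u 0, u i)) ?_ ?_ ?_ ?_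
    · exact ((continuous_const.mul (hFc x)).add (continuous_const.mul (hFc y))).sub (hFc _)
    · exact (((hFi x).const_mul a).add ((hFi y).const_mul b)).sub (hFi _)
    · intro p
      have := strictConvexOn_sqCorrInfo.convexOn.2 (mem_Icc_of_cube hx p.1 p.2)
        (mem_Icc_of_cube hy p.1 p.2) ha.le hb.le hab
      rw [← harg] at this
      exact sub_nonneg.2 this
    · refine (sub_pos.2 ?_).ne'
      have hne : ((u 0 : E3) 0 ^ 2 * ∑ j, x j * (u i : E3) j ^ 2) ≠
          (u 0 : E3) 0 ^ 2 * ∑ j, y j * (u i : E3) j ^ 2 := by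
        simpa [u, Pi.single_apply] using hi
      have := strictConvexOn_sqCorrInfo.2 (mem_Icc_of_cube hx (u 0) (u i))
        (mem_Icc_of_cube hy (u 0) (u i)) hne ha hb hab
      rw [← harg (u 0, u i)] at this
      exact this
  have hadd : Integrable (fun p => a * F x p + b * F y p) (surface.prod surface) :=
    ((hFi x).const_mul a).add ((hFi y).const_mul b)
  rw [integral_sub hadd (hFi _), integral_add ((hFi x).const_mul a) ((hFi y).const_mul b),
    integral_const_mul, integral_const_mul, sub_pos] at hpos
  have hmass : 0 < ((surface.prod surface).real Set.univ)⁻¹ := by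
    rw [inv_pos, Measure.real, ENNReal.toReal_pos_iff]
    exact ⟨isOpen_univ.measure_pos _ ⟨(u 0, u 0), trivial⟩, measure_lt_top _ _⟩
  have := mul_lt_mul_of_pos_left hpos hmass
  simp only [avgSq, average_eq, smul_eq_mul]
  convert this using 1
  simp only [F]
  ring

/-! ### Isotropic and classical points in terms of squared coordinates -/

theorem mem_sphere_iff_sum_sq {κ : ℝ} (hκ : 0 ≤ κ) (c : E3) :
    c ∈ Metric.sphere 0 κ ↔ ∑ i, c i ^ 2 = κ ^ 2 := by
  rw [mem_sphere_zero_iff_norm, ← sq_eq_sq₀ (norm_nonneg _) hκ, EuclideanSpace.norm_sq_eq]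
  simp only [Real.norm_eq_abs, sq_abs]

theorem mem_scaled_luClass_iff (κ : ℝ) (c d : E3) :
    c ∈ scaled κ (luClass d) ↔ ∃ σ : Equiv.Perm (Fin 3), ∀ i, c i ^ 2 = (κ * d (σ i)) ^ 2 := by
  constructor
  · rintro ⟨e, ⟨s, σ, he⟩, rfl⟩
    refine ⟨σ, fun i => ?_⟩
    rcases Int.units_eq_one_or (s i) with h | h <;> simp [he, h]
  · rintro ⟨σ, h⟩
    have hs : ∀ i, ∃ s : ℤˣ, c i = ((s : ℤ) : ℝ) * (κ * d (σ i)) := by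
      intro i
      rcases sq_eq_sq_iff_eq_or_eq_neg.1 (h i) with h | h
      · exact ⟨1, by simp [h]⟩
      · exact ⟨-1, by simp [h]⟩
    choose s hs using hs
    refine ⟨WithLp.toLp 2 fun i => ((s i : ℤ) : ℝ) * d (σ i), ⟨s, σ, fun i => rfl⟩, ?_⟩
    ext i
    simp only [hs i, PiLp.smul_apply, smul_eq_mul]
    ring

theorem mem_scaled_isotropicDirs_iff (κ : ℝ) (c : E3) :
    c ∈ scaled κ isotropicDirs ↔ (fun i => c i ^ 2) = fun _ => κ ^ 2 / 3 := by
  have hd : ∀ i : Fin 3, (κ * (!₂[1 / √3, 1 / √3, 1 / √3] : E3) i) ^ 2 = κ ^ 2 / 3 := by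
    intro i
    have h3 : (κ * (1 / √3)) ^ 2 = κ ^ 2 / 3 := by
      rw [mul_pow, div_pow, Real.sq_sqrt zero_le_three]
      ring
    fin_cases i <;> exact h3
  rw [isotropicDirs, mem_scaled_luClass_iff, funext_iff]
  simp only [hd, exists_const]

theorem mem_scaled_classicalDirs_iff (κ : ℝ) (c : E3) :
    c ∈ scaled κ classicalDirs ↔ ∃ i, (fun j => c j ^ 2) = Pi.single i (κ ^ 2) := by
  have hd : ∀ i : Fin 3, (κ * (!₂[0, 0, 1] : E3) i) ^ 2 =
      Pi.single (M := fun _ => ℝ) 2 (κ ^ 2) i := by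
    intro i
    fin_cases i <;> simp
  rw [classicalDirs, mem_scaled_luClass_iff]
  simp only [hd, funext_iff]
  constructor
  · rintro ⟨σ, h⟩
    refine ⟨σ.symm 2, fun j => (h j).trans ?_⟩
    simp only [Pi.single_apply, Equiv.eq_symm_apply]
  · rintro ⟨i, h⟩
    refine ⟨Equiv.swap i 2, fun j => (h j).trans ?_⟩
    simp only [Pi.single_apply, ← Equiv.eq_symm_apply, Equiv.symm_swap, Equiv.swap_apply_right]

theorem scaled_isotropicDirs_subset_sphere {κ : ℝ} (hκ : 0 ≤ κ) :
    scaled κ isotropicDirs ⊆ Metric.sphere 0 κ := by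
  intro c hc
  rw [mem_scaled_isotropicDirs_iff] at hc
  rw [mem_sphere_iff_sum_sq hκ, hc]
  simp
  ring

theorem scaled_classicalDirs_subset_sphere {κ : ℝ} (hκ : 0 ≤ κ) :
    scaled κ classicalDirs ⊆ Metric.sphere 0 κ := by
  intro c hc
  obtain ⟨i, hi⟩ := (mem_scaled_classicalDirs_iff κ c).1 hc
  rw [mem_sphere_iff_sum_sq hκ, hi]
  simp

theorem stateVectors_inter_isotropic_nonempty {κ : ℝ} (hκ : 0 ≤ κ) (h3 : κ ≤ √3) :
    (stateVectors κ ∩ scaled κ isotropicDirs).Nonempty := by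
  have h0 : 0 < √3 := Real.sqrt_pos.2 three_pos
  have hle : κ / √3 ≤ 1 := (div_le_one h0).2 h3
  have hnn : 0 ≤ κ / √3 := by positivity
  have hc : (!₂[-(κ / √3), -(κ / √3), -(κ / √3)] : E3) ∈ scaled κ isotropicDirs := by
    rw [mem_scaled_isotropicDirs_iff]
    funext i
    fin_cases i <;> simp [div_pow]
  refine ⟨_, mem_stateVectors_iff.2 ⟨?_, ?_⟩, hc⟩
  · exact mem_sphere_zero_iff_norm.1 (scaled_isotropicDirs_subset_sphere hκ hc)
  · rw [mem_tetrahedron_iff]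
    intro k
    fin_cases k <;> simp [bellWeight] <;> linarith

theorem scaled_classicalDirs_subset_stateVectors {κ : ℝ} (hκ : 0 ≤ κ) (h1 : κ ≤ 1) :
    scaled κ classicalDirs ⊆ stateVectors κ := by
  intro c hc
  refine mem_stateVectors_iff.2
    ⟨mem_sphere_zero_iff_norm.1 (scaled_classicalDirs_subset_sphere hκ hc), ?_⟩
  obtain ⟨i, hi⟩ := (mem_scaled_classicalDirs_iff κ c).1 hc
  have habs : |c i| ≤ 1 := by
    rw [← sq_le_one_iff_abs_le_one, congrFun hi i, Pi.single_eq_same]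
    exact pow_le_one₀ hκ h1
  have hz : ∀ j, j ≠ i → c j = 0 := fun j hj => by
    simpa [hj] using congrFun hi j
  obtain ⟨hl, hu⟩ := abs_le.1 habs
  rw [mem_tetrahedron_iff]
  intro k
  fin_cases i <;> fin_cases k <;> simp [bellWeight, hz] <;> dsimp at hl hu <;> linarith

/-! ### Minima and maxima -/

/-- The mean of the three cyclic shifts of `a` is constant, so that the value there is smaller by
strict convexity and symmetry. -/
theorem avgSq_const_lt {a : Fin 3 → ℝ} {K : ℝ} (ha : a ∈ Set.Icc 0 1) (hK : ∑ i, a i = K)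
    (hne : a ≠ fun _ => K / 3) : avgSq (fun _ => K / 3) < avgSq a := by
  have hmem : ∀ k : Fin 3, (fun i => a (Equiv.addRight k i)) ∈ Set.Icc (0 : Fin 3 → ℝ) 1 :=
    fun k => ⟨fun i => ha.1 (i + k), fun i => ha.2 (i + k)⟩
  have hneq : (fun i => a (Equiv.addRight (0 : Fin 3) i)) ≠ fun i => a (Equiv.addRight 1 i) := by
    intro h
    apply hne
    have h0 : a 0 = a 1 := congrFun h 0
    have h1 : a 1 = a 2 := congrFun h 1
    rw [Fin.sum_univ_three] at hK
    funext i
    fin_cases i <;> dsimp <;> linarith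
  have hlt := strictConvexOn_avgSq.map_sum_lt (t := Finset.univ) (w := fun _ : Fin 3 => (1 / 3 : ℝ))
    (p := fun k i => a (Equiv.addRight k i)) (fun _ _ => by norm_num) (by simp)
    (fun k _ => hmem k) ⟨0, Finset.mem_univ _, 1, Finset.mem_univ _, hneq⟩
  have hsum : ∑ k : Fin 3, (1 / 3 : ℝ) • (fun i => a (Equiv.addRight k i)) = fun _ => K / 3 := by
    funext i
    rw [← hK]
    fin_cases i <;> simp [Fin.sum_univ_three] <;> ring
  simp only [avgSq_comp_perm, hsum] at hlt
  simpa using hlt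

theorem avgSq_single (i j : Fin 3) (K : ℝ) : avgSq (Pi.single i K) = avgSq (Pi.single j K) := by
  rw [← avgSq_comp_perm (Pi.single j K) (Equiv.swap i j)]
  congr 1
  funext k
  simp only [Pi.single_apply, ← Equiv.eq_symm_apply, Equiv.symm_swap, Equiv.swap_apply_right]

/-- A point of the simplex is the convex combination of the vertices `K e_i` with weights
`a i / K`, and the vertices have equal values. -/
theorem avgSq_lt_single {a : Fin 3 → ℝ} {K : ℝ} (ha : 0 ≤ a) (hK : ∑ i, a i = K) (hK1 : K ≤ 1)
    (hne : ∀ i, a ≠ Pi.single i K) (j : Fin 3) : avgSq a < avgSq (Pi.single j K) := by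
  have hK0 : 0 < K := by
    refine (hK ▸ Finset.sum_nonneg fun i _ => ha i : 0 ≤ K).lt_of_ne fun h => hne 0 ?_
    rw [← h] at hK ⊢
    rw [Finset.sum_eq_zero_iff_of_nonneg fun i _ => ha i] at hK
    funext i
    simpa using hK i (Finset.mem_univ i)
  have hmem : ∀ i, (Pi.single i K : Fin 3 → ℝ) ∈ Set.Icc (0 : Fin 3 → ℝ) 1 := by
    intro i
    refine ⟨Pi.single_nonneg.2 hK0.le, fun k => ?_⟩
    rw [Pi.single_apply]
    split_ifs
    · exact hK1
    · exact zero_le_one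
  have hsum : ∑ i, (a i / K) • (Pi.single i K : Fin 3 → ℝ) = a := by
    funext k
    simp [Finset.sum_apply, Pi.single_apply, hK0.ne']
  have hw : ∑ i, a i / K = 1 := by rw [← Finset.sum_div, hK, div_self hK0.ne']
  have hlt := (strictConvexOn_avgSq.map_sum_lt_iff_of_nonneg (t := Finset.univ)
    (w := fun i : Fin 3 => a i / K) (p := fun i => Pi.single i K)
    (fun i _ => div_nonneg (ha i) hK0.le) hw (fun i _ => hmem i)).2 ?_
  · rw [hsum] at hlt
    have hval : ∀ i, avgSq (Pi.single i K) = avgSq (Pi.single j K) := fun i => avgSq_single i j K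
    simp only [hval, smul_eq_mul, ← Finset.sum_mul, hw, one_mul] at hlt
    exact hlt
  · -- Two coordinates are positive, since otherwise `a` would be a vertex.
    obtain ⟨i, -, hi⟩ : ∃ i ∈ Finset.univ, a i ≠ 0 :=
      Finset.exists_ne_zero_of_sum_ne_zero (hK ▸ hK0.ne')
    obtain ⟨k, hki, hk⟩ : ∃ k, k ≠ i ∧ a k ≠ 0 := by
      by_contra! h
      rw [Finset.sum_eq_single i (fun k _ hk => h k hk) (by simp)] at hK
      refine hne i (funext fun k => ?_)
      rcases eq_or_ne k i with rfl | hk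
      · rw [hK, Pi.single_eq_same]
      · rw [h k hk, Pi.single_eq_of_ne hk]
    refine ⟨i, Finset.mem_univ i, k, Finset.mem_univ k, div_ne_zero hi hK0.ne',
      div_ne_zero hk hK0.ne', fun h => ?_⟩
    have := congrFun h i
    rw [Pi.single_eq_same, Pi.single_eq_of_ne hki.symm] at this
    exact hK0.ne' this

theorem minimizers_eq {κ : ℝ} {D : Set E3} (hκ : 0 ≤ κ) (hD : D ⊆ Metric.sphere 0 κ)
    (hD1 : ∀ c ∈ D, ∀ i, c i ^ 2 ≤ 1) (hne : (D ∩ scaled κ isotropicDirs).Nonempty) :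
    minimizers D = D ∩ scaled κ isotropicDirs := by
  have hmin : ∀ c ∈ D, c ∉ scaled κ isotropicDirs → ∀ d ∈ scaled κ isotropicDirs,
      avgInfo d < avgInfo c := by
    intro c hc hcn d hd
    rw [mem_scaled_isotropicDirs_iff] at hcn hd
    rw [avgInfo_eq_avgSq, avgInfo_eq_avgSq, hd]
    exact avgSq_const_lt ⟨fun i => sq_nonneg _, hD1 c hc⟩
      ((mem_sphere_iff_sum_sq hκ c).1 (hD hc)) hcn
  obtain ⟨d, hdD, hd⟩ := hne
  ext c
  constructor
  · rintro ⟨hcD, hc⟩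
    refine ⟨hcD, by_contra fun hcn => ?_⟩
    exact (hmin c hcD hcn d hd).not_ge (hc hdD)
  · rintro ⟨hcD, hc⟩
    refine ⟨hcD, fun e he => ?_⟩
    by_cases hen : e ∈ scaled κ isotropicDirs
    · rw [mem_scaled_isotropicDirs_iff] at hc hen
      simp only [Set.mem_ofPred_eq, avgInfo_eq_avgSq, hc, hen, le_refl]
    · exact (hmin e he hen c hc).le

theorem maximizers_eq {κ : ℝ} {D : Set E3} (hκ : 0 ≤ κ) (h1 : κ ≤ 1)
    (hD : D ⊆ Metric.sphere 0 κ) (hcl : scaled κ classicalDirs ⊆ D) :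
    maximizers D = scaled κ classicalDirs := by
  have hmax : ∀ c ∈ D, c ∉ scaled κ classicalDirs → ∀ d ∈ scaled κ classicalDirs,
      avgInfo c < avgInfo d := by
    intro c hc hcn d hd
    rw [mem_scaled_classicalDirs_iff, not_exists] at hcn
    obtain ⟨j, hj⟩ := (mem_scaled_classicalDirs_iff κ d).1 hd
    rw [avgInfo_eq_avgSq, avgInfo_eq_avgSq, hj]
    exact avgSq_lt_single (fun i => sq_nonneg _) ((mem_sphere_iff_sum_sq hκ c).1 (hD hc))
      (pow_le_one₀ hκ h1) hcn j
  obtain ⟨d, hd⟩ : (scaled κ classicalDirs).Nonempty :=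
    ⟨EuclideanSpace.single 0 κ, (mem_scaled_classicalDirs_iff _ _).2
      ⟨0, by funext j; fin_cases j <;> simp⟩⟩
  ext c
  constructor
  · rintro ⟨hcD, hc⟩
    refine by_contra fun hcn => ?_
    exact (hmax c hcD hcn d hd).not_ge (hc (hcl hd))
  · intro hc
    refine ⟨hcl hc, fun e he => ?_⟩
    by_cases hen : e ∈ scaled κ classicalDirs
    · obtain ⟨i, hi⟩ := (mem_scaled_classicalDirs_iff κ c).1 hc
      obtain ⟨j, hj⟩ := (mem_scaled_classicalDirs_iff κ e).1 hen
      simp only [Set.mem_ofPred_eq, avgInfo_eq_avgSq, hi, hj]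
      exact (avgSq_single j i _).le
    · exact (hmax e he hen c hc).le

/-! ### Local maxima on a sphere -/

/-- A point of the interior of the tetrahedron outside the open unit ball does not lie on a
coordinate axis. -/
theorem exists_two_ne_zero {κ : ℝ} (h1 : 1 ≤ κ) {c : E3} (hc : ‖c‖ = κ)
    (hint : c ∈ interior tetrahedron) : ∃ i j, i ≠ j ∧ c i ≠ 0 ∧ c j ≠ 0 := by
  by_contra! h
  have hcs := (mem_sphere_iff_sum_sq (zero_le_one.trans h1) c).1 (mem_sphere_zero_iff_norm.2 hc)
  obtain ⟨i, -, hi⟩ : ∃ i ∈ Finset.univ, c i ^ 2 ≠ 0 :=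
    Finset.exists_ne_zero_of_sum_ne_zero (by rw [hcs]; positivity)
  have hi0 : c i ≠ 0 := by simpa using hi
  rw [Finset.sum_eq_single i (fun j _ hj => by simp [h i j hj.symm hi0]) (by simp)] at hcs
  have hcont : Filter.Tendsto (fun δ : ℝ => (1 + δ) • c) (nhds 0) (nhds c) := by
    have : Continuous fun δ : ℝ => (1 + δ) • c := by fun_prop
    simpa using this.tendsto 0
  have hev := hcont.eventually (isOpen_interior.mem_nhds hint)
  obtain ⟨δ, hδ, hpos⟩ :=
    ((hev.filter_mono nhdsWithin_le_nhds).and (self_mem_nhdsWithin (s := Set.Ioi (0 : ℝ)))).exists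
  have hle := sq_le_one_of_mem_tetrahedron (interior_subset hδ) i
  rw [PiLp.smul_apply, smul_eq_mul, mul_pow, hcs] at hle
  have hpos' : 0 < δ := hpos
  nlinarith [one_le_pow₀ h1 (n := 2)]

/-- The curve on the sphere through `c` that adds `ε` to the `i`-th and subtracts `ε` from the
`j`-th squared coordinate. -/
noncomputable def transferCurve (c : E3) (i j : Fin 3) (ε : ℝ) : E3 :=
  WithLp.toLp 2 fun k =>
    SignType.sign (c k) * √(c k ^ 2 + ε * (Pi.single i 1 - Pi.single j 1 : Fin 3 → ℝ) k)

theorem transferCurve_zero (c : E3) (i j : Fin 3) : transferCurve c i j 0 = c := by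
  ext k
  simp [transferCurve, Real.sqrt_sq_eq_abs, sign_mul_abs]

theorem continuous_transferCurve (c : E3) (i j : Fin 3) : Continuous (transferCurve c i j) := by
  unfold transferCurve
  fun_prop

theorem eventually_sq_transferCurve {c : E3} {i j : Fin 3} (hi : c i ≠ 0) (hj : c j ≠ 0) :
    ∀ᶠ ε in nhds 0, (fun k => transferCurve c i j ε k ^ 2) =
      (fun k => c k ^ 2) + ε • (Pi.single i 1 - Pi.single j 1 : Fin 3 → ℝ) := by
  have hk : ∀ k, ∀ᶠ ε in nhds (0 : ℝ), transferCurve c i j ε k ^ 2 =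
      c k ^ 2 + ε * (Pi.single i 1 - Pi.single j 1 : Fin 3 → ℝ) k := by
    intro k
    by_cases h : c k = 0
    · have hki : k ≠ i := fun e => hi (e ▸ h)
      have hkj : k ≠ j := fun e => hj (e ▸ h)
      exact Filter.Eventually.of_forall fun ε => by simp [transferCurve, h, hki, hkj]
    · have hcont : Filter.Tendsto (fun ε : ℝ => c k ^ 2 +
          ε * (Pi.single i 1 - Pi.single j 1 : Fin 3 → ℝ) k) (nhds 0) (nhds (c k ^ 2)) := by
        have : Continuous fun ε : ℝ => c k ^ 2 +
          ε * (Pi.single i 1 - Pi.single j 1 : Fin 3 → ℝ) k := by fun_prop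
        simpa using this.tendsto 0
      filter_upwards [hcont.eventually (lt_mem_nhds (by positivity : 0 < c k ^ 2))] with ε hε
      have hs : ((SignType.sign (c k) : SignType) : ℝ) ^ 2 = 1 := by
        rcases lt_or_gt_of_ne h with h | h <;> simp [h]
      simp only [transferCurve]
      rw [mul_pow, hs, one_mul, Real.sq_sqrt hε.le]
  filter_upwards [Filter.eventually_all.2 hk] with ε hε
  funext k
  simpa using hε k

theorem mem_frontier_of_isLocalMaxOn {κ : ℝ} (h1 : 1 ≤ κ) {c : E3} (hc : c ∈ stateVectors κ)
    (hmax : IsLocalMaxOn avgInfo (stateVectors κ) c) : c ∈ frontier tetrahedron := by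
  have hκ : 0 ≤ κ := zero_le_one.trans h1
  obtain ⟨hnorm, hmem⟩ := mem_stateVectors_iff.1 hc
  refine ⟨subset_closure hmem, fun hint => ?_⟩
  obtain ⟨i, j, hij, hi, hj⟩ := exists_two_ne_zero h1 hnorm hint
  have hcs := (mem_sphere_iff_sum_sq hκ c).1 (mem_sphere_zero_iff_norm.2 hnorm)
  have hcont : Filter.Tendsto (transferCurve c i j) (nhds 0) (nhds c) := by
    simpa [transferCurve_zero] using (continuous_transferCurve c i j).tendsto 0
  set v : Fin 3 → ℝ := Pi.single i 1 - Pi.single j 1 with hv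
  have hgood : ∀ᶠ ε in nhds (0 : ℝ), (fun k => c k ^ 2) + ε • v ∈ Set.Icc 0 1 ∧
      avgSq ((fun k => c k ^ 2) + ε • v) ≤ avgSq fun k => c k ^ 2 := by
    have hloc := hcont.eventually (eventually_nhdsWithin_iff.1 hmax)
    filter_upwards [eventually_sq_transferCurve hi hj,
      hcont.eventually (isOpen_interior.mem_nhds hint), hloc] with ε hsq hin hle
    have hstate : transferCurve c i j ε ∈ stateVectors κ := by
      refine mem_stateVectors_iff.2 ⟨mem_sphere_zero_iff_norm.1
        ((mem_sphere_iff_sum_sq hκ _).2 ?_), interior_subset hin⟩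
      rw [hsq, ← hcs]
      simp [Finset.sum_add_distrib, ← Finset.mul_sum]
    rw [← hv] at hsq
    have := hle hstate
    rw [avgInfo_eq_avgSq, avgInfo_eq_avgSq, hsq] at this
    refine ⟨?_, this⟩
    rw [← hsq]
    exact ⟨fun k => sq_nonneg _, sq_le_one_of_mem_tetrahedron (interior_subset hin)⟩
  -- The values at `ε` and `-ε` are both at most the value at their midpoint `0`.
  have hneg := (show Filter.Tendsto (fun ε : ℝ => -ε) (nhds 0) (nhds 0) by
    simpa using (continuous_neg (G := ℝ)).tendsto 0).eventually hgood
  obtain ⟨ε, ⟨⟨hp, hple⟩, hm, hmle⟩, hε⟩ := (((hgood.and hneg).filter_mono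
    nhdsWithin_le_nhds).and (self_mem_nhdsWithin (s := Set.Ioi (0 : ℝ)))).exists
  have hε' : 0 < ε := hε
  have hne : (fun k => c k ^ 2) + ε • v ≠ (fun k => c k ^ 2) + (-ε) • v := by
    intro h
    have := congrFun h i
    simp [hv, hij] at this
    linarith
  have hlt := strictConvexOn_avgSq.2 hp hm hne one_half_pos one_half_pos (add_halves 1)
  have hmid : (1 / 2 : ℝ) • ((fun k => c k ^ 2) + ε • v) +
      (1 / 2 : ℝ) • ((fun k => c k ^ 2) + (-ε) • v) = fun k => c k ^ 2 := by
    funext k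
    simp
    ring
  rw [hmid] at hlt
  simp only [smul_eq_mul] at hlt
  linarith

theorem isCompact_stateVectors (κ : ℝ) : IsCompact (stateVectors κ) := by
  have h : stateVectors κ = Metric.sphere 0 κ ∩ tetrahedron := by
    ext c
    rw [mem_stateVectors_iff, Set.mem_inter_iff, mem_sphere_zero_iff_norm]
  rw [h]
  exact (isCompact_sphere 0 κ).inter_right isClosed_tetrahedron

end TwoQubit

theorem proposition1 (κ : ℝ) (hκ : 0 ≤ κ) :
    (κ ≤ 1 →
      ((stateVectors κ ∩ scaled κ isotropicDirs).Nonempty ∧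
        minimizers (stateVectors κ) = stateVectors κ ∩ scaled κ isotropicDirs ∧
        maximizers (stateVectors κ) = scaled κ classicalDirs) ∧
      (minimizers (Metric.sphere 0 κ) = scaled κ isotropicDirs ∧
        maximizers (Metric.sphere 0 κ) = scaled κ classicalDirs)) ∧
    (1 ≤ κ → κ ≤ √3 →
      ((stateVectors κ ∩ scaled κ isotropicDirs).Nonempty ∧
        minimizers (stateVectors κ) = stateVectors κ ∩ scaled κ isotropicDirs) ∧
      ((maximizers (stateVectors κ)).Nonempty ∧
        maximizers (stateVectors κ) ⊆ Metric.sphere 0 κ ∩ frontier tetrahedron ∧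
        ∀ c ∈ stateVectors κ, IsLocalMaxOn avgInfo (stateVectors κ) c →
          c ∈ Metric.sphere 0 κ ∩ frontier tetrahedron)) := by
  have hsub : stateVectors κ ⊆ Metric.sphere 0 κ := fun c hc =>
    mem_sphere_zero_iff_norm.2 hc.1
  have hsq : ∀ c ∈ stateVectors κ, ∀ i, c i ^ 2 ≤ 1 := fun c hc =>
    sq_le_one_of_mem_tetrahedron (mem_stateVectors_iff.1 hc).2
  constructor
  · intro h1
    have hne := stateVectors_inter_isotropic_nonempty hκ
      (h1.trans (Real.one_le_sqrt.2 (by norm_num)))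
    refine ⟨⟨hne, minimizers_eq hκ hsub hsq hne, maximizers_eq hκ h1 hsub
      (scaled_classicalDirs_subset_stateVectors hκ h1)⟩, ?_, maximizers_eq hκ h1 subset_rfl
      (scaled_classicalDirs_subset_sphere hκ)⟩
    rw [minimizers_eq hκ subset_rfl _ (hne.mono (Set.inter_subset_inter_left _ hsub)),
      Set.inter_eq_right.2 (scaled_isotropicDirs_subset_sphere hκ)]
    intro c hc i
    rw [mem_sphere_iff_sum_sq hκ] at hc
    calc c i ^ 2 ≤ ∑ j, c j ^ 2 :=
          Finset.single_le_sum (fun j _ => sq_nonneg (c j)) (Finset.mem_univ i)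
      _ ≤ 1 := hc ▸ pow_le_one₀ hκ h1
  · intro h1 h3
    have hne := stateVectors_inter_isotropic_nonempty hκ h3
    have hloc : ∀ c ∈ stateVectors κ, IsLocalMaxOn avgInfo (stateVectors κ) c →
        c ∈ Metric.sphere 0 κ ∩ frontier tetrahedron := fun c hc hmax =>
      ⟨hsub hc, mem_frontier_of_isLocalMaxOn h1 hc hmax⟩
    refine ⟨⟨hne, minimizers_eq hκ hsub hsq hne⟩, ?_, fun c hc => hloc c hc.1 hc.2.localize, hloc⟩
    obtain ⟨c, hc, hmax⟩ := (isCompact_stateVectors κ).exists_isMaxOn hne.left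
      continuous_avgInfo.continuousOn
    exact ⟨c, hc, hmax⟩
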